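/- Let $[n]=\{1,\dots,n\}$. A binary linear code $C\subseteq\mathbb{F}_2^n$ of length $n$ and dimension $s$ is called a $k$-PIR code if it admits a generator matrix $G\in\mathbb{F}_2^{s\times n}$ (a matrix whose rows form a basis of $C$) such that for every $i\in\{1,\dots,s\}$ there exist $k$ mutually disjoint sets $R^i_1,\dots,R^i_k\subseteq[n]$ with $\sum_{h\in R^i_j}G^h=e_i$ for all $1\le j\le k$, where $G^h$ denotes the $h$th column of $G$ and $e_i$ the $i$th unit vector of $\mathbb{F}_2^s$. Let $P(s,k)$ denote the smallest $n$ such that an $s$-dimensional binary $k$-PIR code of length $n$ exists. **Theorem.** $P(5,8)=18$. That is, there is a binary $5$-dimensional $8$-PIR code of length $18$, and there is none of smaller length. -/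

import Mathlib

/-- A binary linear code of length `n` is a subspace of `𝔽₂ⁿ`; the matrix `G` generates the
code `C` if its rows form a basis of `C`. -/
def IsGeneratorMatrix {s n : ℕ} (G : Matrix (Fin s) (Fin n) (ZMod 2))
    (C : Submodule (ZMod 2) (Fin n → ZMod 2)) : Prop :=
  LinearIndependent (ZMod 2) G.row ∧ Submodule.span (ZMod 2) (Set.range G.row) = C

/-- `R` is a recovery set for the `i`-th information bit with respect to `G`:
the columns of `G` with index in `R` sum to the `i`-th unit vector. -/
def IsRecoverySet {s n : ℕ} (G : Matrix (Fin s) (Fin n) (ZMod 2)) (i : Fin s)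
    (R : Finset (Fin n)) : Prop :=
  ∑ h ∈ R, G.col h = Pi.single i 1

/-- The binary linear code `C` of length `n` is an `s`-dimensional `k`-PIR code: it has
dimension `s` and admits a generator matrix for which every information bit has `k` mutually
disjoint recovery sets. -/
def IsPIRCode {n : ℕ} (s k : ℕ) (C : Submodule (ZMod 2) (Fin n → ZMod 2)) : Prop :=
  Module.finrank (ZMod 2) C = s ∧
    ∃ G : Matrix (Fin s) (Fin n) (ZMod 2), IsGeneratorMatrix G C ∧
      ∀ i : Fin s, ∃ R : Fin k → Finset (Fin n),
        Pairwise (fun j j' => Disjoint (R j) (R j')) ∧ ∀ j, IsRecoverySet G i (R j)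

/-- The lengths `n` for which an `s`-dimensional `k`-PIR code of length `n` exists. -/
def pirLengths (s k : ℕ) : Set ℕ :=
  {n | ∃ C : Submodule (ZMod 2) (Fin n → ZMod 2), IsPIRCode s k C}

/-- `P(s, k)`: the smallest length of an `s`-dimensional `k`-PIR code.
(`sInf ∅ = 0` in `ℕ`, so a positive value is attained.) -/
noncomputable def pirLength (s k : ℕ) : ℕ := sInf (pirLengths s k)

/-! Suppose that 17 columns give an 8-PIR code. Every nonzero functional then has weight at least 8.
Deleting coordinate `i` turns the recovery sets of `i` into eight disjoint nonempty zero-sum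
families among 17 vectors of 𝔽₂⁴. The key claim (`exists_fourteen_le_weight`) is that some
functional of weight at least 14 ignores coordinate `i`. Two distinct functionals of weight at least
14 would have a sum of weight at most 3 + 3 < 8, so the same functional serves every `i`. It ignores
all coordinates, hence is zero, which is absurd.

For the claim, a zero-sum family of fewer than three vectors is a pair of equal vectors or contains
0. If 0 does not occur, counting forces seven pairs. The weight bound makes their values distinct
and sum-free, and second and third character moments place them off a hyperplane. If 0 occurs, a
quadratic moment bound leaves one extremal case, excluded modulo 10. -/

open Finset

namespace PIR

/-- The nontrivial character of `𝔽₂` with values in `ℤ`. -/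
def sgn (a : ZMod 2) : ℤ := if a = 0 then 1 else -1

theorem sgn_add (a b : ZMod 2) : sgn (a + b) = sgn a * sgn b := by
  revert a b; decide

theorem sgn_zero : sgn 0 = 1 := rfl

theorem neg_one_le_sgn (a : ZMod 2) : -1 ≤ sgn a := by
  revert a; decide

theorem eq_of_add_eq_zero {V : Type*} [AddCommGroup V] [Module (ZMod 2) V] {a b : V}
    (h : a + b = 0) : a = b := by
  rw [eq_neg_of_add_eq_zero_left h, ZModModule.neg_eq_self]

/-! ### Character sums and their first three moments -/

section Characters

variable {m ι : Type*} [Fintype m]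

/-- The character sum of the family `x` over `S`. -/
def charSum (S : Finset ι) (x : ι → m → ZMod 2) (φ : m → ZMod 2) : ℤ :=
  ∑ h ∈ S, sgn (φ ⬝ᵥ x h)

/-- The number of members of the family `x` over `S` outside the hyperplane `φ = 0`. -/
def weight (S : Finset ι) (x : ι → m → ZMod 2) (φ : m → ZMod 2) : ℕ :=
  #{h ∈ S | φ ⬝ᵥ x h = 1}

theorem charSum_eq (S : Finset ι) (x : ι → m → ZMod 2) (φ : m → ZMod 2) :
    charSum S x φ = #S - 2 * weight S x φ := by
  have h (a : ZMod 2) : sgn a = 1 - 2 * (if a = 1 then 1 else 0) := by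
    revert a; decide
  simp only [charSum, weight, h, sum_sub_distrib, ← mul_sum, sum_boole]
  simp

theorem charSum_zero (S : Finset ι) (x : ι → m → ZMod 2) : charSum S x 0 = #S := by
  simp [charSum, sgn_zero]

variable [DecidableEq m]

theorem sum_sgn_dotProduct (y : m → ZMod 2) :
    ∑ φ : m → ZMod 2, sgn (φ ⬝ᵥ y) = if y = 0 then 2 ^ Fintype.card m else 0 := by
  split_ifs with hy
  · simp [hy, sgn_zero]
  · obtain ⟨k, hk⟩ : ∃ k, y k ≠ 0 := by
      by_contra! h
      exact hy (funext h)
    have hk1 : y k = 1 := by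
      generalize y k = a at hk
      revert a; decide
    have h := Equiv.sum_comp (Equiv.addRight (Pi.single k 1 : m → ZMod 2))
      (fun φ : m → ZMod 2 => sgn (φ ⬝ᵥ y))
    simp only [Equiv.coe_addRight, add_dotProduct, single_one_dotProduct, hk1, sgn_add] at h
    rw [← sum_mul] at h
    have h1 : sgn 1 = -1 := rfl
    rw [h1] at h
    linarith

theorem sum_sgn_mul_charSum (S : Finset ι) (x : ι → m → ZMod 2) (a : m → ZMod 2) :
    ∑ φ : m → ZMod 2, sgn (φ ⬝ᵥ a) * charSum S x φ =
      2 ^ Fintype.card m * #{h ∈ S | x h = a} := by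
  simp only [charSum, mul_sum, ← sgn_add, ← dotProduct_add]
  rw [sum_comm]
  simp only [sum_sgn_dotProduct]
  have h (k : ι) : a + x k = 0 ↔ x k = a :=
    ⟨fun h => (eq_of_add_eq_zero h).symm, fun h => by rw [h, ZModModule.add_self]⟩
  simp only [h, ← sum_filter, sum_const, nsmul_eq_mul]
  ring

theorem sum_charSum (S : Finset ι) (x : ι → m → ZMod 2) :
    ∑ φ : m → ZMod 2, charSum S x φ = 2 ^ Fintype.card m * #{h ∈ S | x h = 0} := by
  simpa [sgn_zero] using sum_sgn_mul_charSum S x 0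

theorem sum_charSum_sq (S : Finset ι) (x : ι → m → ZMod 2) :
    ∑ φ : m → ZMod 2, charSum S x φ ^ 2 =
      2 ^ Fintype.card m * ∑ h ∈ S, (#{k ∈ S | x k = x h} : ℤ) := by
  simp only [mul_sum, ← sum_sgn_mul_charSum]
  rw [sum_comm]
  exact sum_congr rfl fun φ _ => by rw [← sum_mul, sq]; rfl

theorem sum_charSum_cube (S : Finset ι) (x : ι → m → ZMod 2) :
    ∑ φ : m → ZMod 2, charSum S x φ ^ 3 =
      2 ^ Fintype.card m * ∑ h ∈ S, ∑ k ∈ S, (#{l ∈ S | x l = x h + x k} : ℤ) := by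
  simp only [mul_sum, ← sum_sgn_mul_charSum, dotProduct_add, sgn_add]
  simp only [sum_comm (s := S) (t := univ)]
  refine sum_congr rfl fun φ _ => ?_
  simp only [← sum_mul, ← mul_sum]
  simp only [charSum]
  ring

/-- A sum-free family of seven vectors in `𝔽₂⁴` avoids a hyperplane. -/
theorem exists_forall_dotProduct_eq_one_of_sumFree (S : Finset ι) (x : ι → Fin 4 → ZMod 2)
    (hS : #S = 7) (hx : Set.InjOn x S)
    (hsum : ∀ h ∈ S, ∀ k ∈ S, ∀ l ∈ S, x l ≠ x h + x k) :
    ∃ φ : Fin 4 → ZMod 2, ∀ h ∈ S, φ ⬝ᵥ x h = 1 := by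
  by_contra! hcon
  have hF (φ : Fin 4 → ZMod 2) : -5 ≤ charSum S x φ := by
    have : weight S x φ < #S := by
      obtain ⟨h, hh, hne⟩ := hcon φ
      exact card_lt_card (filter_ssubset.2 ⟨h, hh, hne⟩)
    rw [charSum_eq]
    omega
  have h2 : ∑ φ : Fin 4 → ZMod 2, charSum S x φ ^ 2 = 112 := by
    rw [sum_charSum_sq, sum_congr rfl (g := fun _ => (1 : ℤ))]
    · simp [hS]
    · intro h hh
      have : ({k ∈ S | x k = x h} : Finset ι) = {h} := by
        ext k
        simp only [mem_filter, mem_singleton]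
        exact ⟨fun hk => hx hk.1 hh hk.2, by rintro rfl; exact ⟨hh, rfl⟩⟩
      simp [this]
  have h3 : ∑ φ : Fin 4 → ZMod 2, charSum S x φ ^ 3 = 0 := by
    rw [sum_charSum_cube, sum_eq_zero, mul_zero]
    refine fun h hh => sum_eq_zero fun k hk => ?_
    simpa [filter_eq_empty_iff] using hsum h hh k hk
  -- The term at 0 is 343 + 5 · 49 = 588, whereas the total is 0 + 5 · 112 = 560.
  have hle : charSum S x 0 ^ 3 + 5 * charSum S x 0 ^ 2 ≤
      ∑ φ : Fin 4 → ZMod 2, (charSum S x φ ^ 3 + 5 * charSum S x φ ^ 2) :=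
    single_le_sum (f := fun φ => charSum S x φ ^ 3 + 5 * charSum S x φ ^ 2)
      (fun φ _ => by nlinarith [hF φ, sq_nonneg (charSum S x φ)]) (mem_univ 0)
  rw [sum_add_distrib, ← mul_sum, h2, h3, charSum_zero, hS] at hle
  norm_num at hle

end Characters

/-! ### Counting disjoint zero-sum families -/

section Pairs

/-- The indices of the sets among `R` consisting of two nonzero members of `x`. -/
def pairIndices {ι κ m : Type*} [Fintype κ] [Fintype m] [DecidableEq m]
    (x : ι → m → ZMod 2) (R : κ → Finset ι) : Finset κ :=
  {j | (∀ h ∈ R j, x h ≠ 0) ∧ #(R j) = 2}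

variable {ι κ m : Type*} [Fintype κ] [Fintype m] [DecidableEq m]
  {x : ι → m → ZMod 2} {R : κ → Finset ι}

theorem mem_pairIndices {j : κ} :
    j ∈ pairIndices x R ↔ (∀ h ∈ R j, x h ≠ 0) ∧ #(R j) = 2 := by
  simp [pairIndices]

theorem eq_of_mem_pair (hsum : ∀ j, ∑ h ∈ R j, x h = 0) {j : κ}
    (hj : j ∈ pairIndices x R) {h k : ι} (hh : h ∈ R j) (hk : k ∈ R j) : x h = x k := by
  classical
  by_cases hhk : h = k
  · rw [hhk]
  have hj2 : #(R j) = 2 := (mem_pairIndices.1 hj).2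
  have : R j = {h, k} := by
    refine (eq_of_subset_of_card_le ?_ ?_).symm
    · simp [insert_subset_iff, hh, hk]
    · rw [card_pair hhk, hj2]
  have hs := hsum j
  rw [this, sum_pair hhk] at hs
  exact eq_of_add_eq_zero hs

theorem card_biUnion_pairs [DecidableEq ι]
    (hdisj : Pairwise fun j j' => Disjoint (R j) (R j'))
    {S : Finset κ} (hS : S ⊆ pairIndices x R) : #(S.biUnion R) = 2 * #S := by
  rw [card_biUnion fun j _ j' _ hne => hdisj hne,
    sum_congr rfl fun j hj => (mem_pairIndices.1 (hS hj)).2]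
  simp [mul_comm]

variable [Fintype ι] [DecidableEq ι]

/-- A zero-sum set has at least three members, except that a pair of equal nonzero vectors falls
short by one and a set containing 0 by at most two. -/
theorem three_mul_card_le (hdisj : Pairwise fun j j' => Disjoint (R j) (R j'))
    (hne : ∀ j, (R j).Nonempty) (hsum : ∀ j, ∑ h ∈ R j, x h = 0) :
    3 * Fintype.card κ ≤ Fintype.card ι + #(pairIndices x R) + 2 * #{h | x h = 0} := by
  classical
  have hj (j : κ) : 3 ≤ #(R j) + (if j ∈ pairIndices x R then 1 else 0) + 2 * #{h ∈ R j | x h = 0} := by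
    by_cases hz : ∀ h ∈ R j, x h ≠ 0
    · have h1 : #(R j) ≠ 1 := by
        intro h1
        obtain ⟨h, hh⟩ := card_eq_one.1 h1
        refine hz h (by simp [hh]) ?_
        simpa [hh] using hsum j
      have := (hne j).card_pos
      split_ifs with hp
      · have := (mem_pairIndices.1 hp).2
        omega
      · have : #(R j) ≠ 2 := fun h2 => hp (mem_pairIndices.2 ⟨hz, h2⟩)
        omega
    · push Not at hz
      obtain ⟨h, hh, h0⟩ := hz
      have : 0 < #{h ∈ R j | x h = 0} := card_pos.2 ⟨h, by simp [hh, h0]⟩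
      have := (hne j).card_pos
      omega
  have h := sum_le_sum fun j (_ : j ∈ univ) => hj j
  rw [sum_add_distrib, sum_add_distrib, ← mul_sum] at h
  have hR : ∑ j, #(R j) ≤ Fintype.card ι := by
    rw [← card_biUnion fun j _ j' _ hne => hdisj hne]
    exact card_le_univ _
  have hZ : ∑ j, #{h ∈ R j | x h = 0} ≤ #{h | x h = 0} := by
    rw [← card_biUnion fun j _ j' _ hne => disjoint_filter_filter (hdisj hne)]
    refine card_le_card fun h => ?_
    simp
  have hP : ∑ j, (if j ∈ pairIndices x R then 1 else 0) = #(pairIndices x R) := by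
    rw [← card_filter, filter_univ_mem]
  simp only [sum_const, card_univ, smul_eq_mul] at h
  omega

theorem card_add_two_mul_card_pairs_le (hdisj : Pairwise fun j j' => Disjoint (R j) (R j'))
    (hsum : ∀ j, ∑ h ∈ R j, x h = 0) :
    Fintype.card ι + 2 * #(pairIndices x R) ≤ ∑ h, #{k | x k = x h} := by
  have hU : 2 * #(pairIndices x R) =
      ∑ h, if h ∈ (pairIndices x R).biUnion R then 1 else 0 := by
    rw [← card_biUnion_pairs hdisj Subset.rfl, ← card_filter, filter_univ_mem]
  rw [hU, ← card_univ, card_eq_sum_ones, ← sum_add_distrib]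
  refine sum_le_sum fun h _ => ?_
  split_ifs with hh
  · obtain ⟨j, hj, hhj⟩ := mem_biUnion.1 hh
    have hj2 : #(R j) = 2 := (mem_pairIndices.1 hj).2
    refine hj2.symm.le.trans ?_
    exact card_le_card fun k hk => by simp [eq_of_mem_pair hsum hj hk hhj]
  · exact card_pos.2 ⟨h, by simp⟩

end Pairs

/-! ### Seventeen vectors in 𝔽₂⁴ -/

section Projection

variable {ι : Type*} [Fintype ι]

/-- Weight at least 8 means a character sum of at most 17 - 16 = 1 away from 0; at 0 it is 17.
Taking for `c` a multiple of the indicator of an annihilator bounds the number of vectors in a small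
subspace. -/
theorem sum_mul_charSum_le (x : ι → Fin 4 → ZMod 2)
    (hcard : Fintype.card ι = 17) (hw : ∀ φ ≠ 0, 8 ≤ weight univ x φ)
    (c : (Fin 4 → ZMod 2) → ℤ) (hc : ∀ φ, 0 ≤ c φ) :
    ∑ φ, c φ * charSum univ x φ ≤ ∑ φ, c φ + 16 * c 0 := by
  have h : ∑ φ, c φ * charSum univ x φ ≤ ∑ φ, (c φ + if φ = 0 then 16 * c 0 else 0) := by
    refine sum_le_sum fun φ _ => ?_
    split_ifs with h
    · rw [h, charSum_zero, card_univ, hcard]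
      push_cast
      linarith
    · have := hw φ h
      have h1 : charSum univ x φ ≤ 1 := by
        rw [charSum_eq, card_univ, hcard]
        omega
      nlinarith [hc φ]
  simpa [sum_add_distrib] using h

theorem card_fiber_le (x : ι → Fin 4 → ZMod 2)
    (hcard : Fintype.card ι = 17) (hw : ∀ φ ≠ 0, 8 ≤ weight univ x φ)
    {a : Fin 4 → ZMod 2} (ha : a ≠ 0) : #{h | x h = a} ≤ 3 := by
  have h := sum_mul_charSum_le x hcard hw (fun φ => 1 + sgn (φ ⬝ᵥ a))
    (fun φ => by linarith [neg_one_le_sgn (φ ⬝ᵥ a)])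
  simp only [add_mul, one_mul, sum_add_distrib, sum_charSum, sum_sgn_mul_charSum,
    sum_sgn_dotProduct, if_neg ha, zero_dotProduct, sgn_zero] at h
  norm_num at h
  omega

theorem card_fibers_line_le (x : ι → Fin 4 → ZMod 2)
    (hcard : Fintype.card ι = 17) (hw : ∀ φ ≠ 0, 8 ≤ weight univ x φ)
    {a b : Fin 4 → ZMod 2} (ha : a ≠ 0) (hb : b ≠ 0) (hab : a + b ≠ 0) :
    #{h | x h = a} + #{h | x h = b} + #{h | x h = a + b} ≤ 5 := by
  have h := sum_mul_charSum_le x hcard hw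
    (fun φ => (1 + sgn (φ ⬝ᵥ a)) * (1 + sgn (φ ⬝ᵥ b)))
    (fun φ => mul_nonneg (by linarith [neg_one_le_sgn (φ ⬝ᵥ a)])
      (by linarith [neg_one_le_sgn (φ ⬝ᵥ b)]))
  simp only [add_mul, mul_add, one_mul, mul_one, ← sgn_add, ← dotProduct_add, sum_add_distrib,
    sum_charSum, sum_sgn_mul_charSum, sum_sgn_dotProduct, if_neg ha, if_neg hb, if_neg hab,
    zero_dotProduct, sgn_zero] at h
  norm_num at h
  omega

variable [DecidableEq ι] (x : ι → Fin 4 → ZMod 2) (R : Fin 8 → Finset ι)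

theorem exists_fourteen_le_weight_of_zero (hcard : Fintype.card ι = 17)
    (hw : ∀ φ ≠ 0, 8 ≤ weight univ x φ)
    (hdisj : Pairwise fun j j' => Disjoint (R j) (R j'))
    (hne : ∀ j, (R j).Nonempty) (hsum : ∀ j, ∑ h ∈ R j, x h = 0)
    (hzero : 0 < #{h | x h = 0}) :
    ∃ φ, 14 ≤ weight univ x φ := by
  by_contra! hcon
  have h1 := three_mul_card_le hdisj hne hsum
  have h2 := card_add_two_mul_card_pairs_le hdisj hsum
  have s1 := sum_charSum univ x
  have s2 := sum_charSum_sq univ x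
  rw [hcard] at h1 h2
  simp only [Fintype.card_fin] at h1 s1 s2
  rw [← Nat.cast_sum] at s2
  have F0 : charSum univ x 0 = 17 := by rw [charSum_zero, card_univ, hcard]; rfl
  have hF (φ : Fin 4 → ZMod 2) : charSum univ x φ = 17 - 2 * weight univ x φ := by
    rw [charSum_eq, card_univ, hcard]; rfl
  -- With F the character sum, this is (1 - F)(F + 9), nonnegative for -9 ≤ F ≤ 1; at 0, where F =
  -- 17, the product is -416. If z vectors vanish, there are at least 7 - 2z pairs, and the two
  -- counts give a total of at most 64 - 64z.
  set q : (Fin 4 → ZMod 2) → ℤ := fun φ =>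
    (9 - 8 * charSum univ x φ - charSum univ x φ ^ 2) + if φ = 0 then 416 else 0 with hq
  have hq0 (φ : Fin 4 → ZMod 2) : 0 ≤ q φ := by
    simp only [hq]
    split_ifs with h
    · rw [h, F0]; norm_num
    · have := hw φ h
      have := hcon φ
      have h3 : charSum univ x φ ≤ 1 := by rw [hF]; omega
      have h4 : -9 ≤ charSum univ x φ := by rw [hF]; omega
      nlinarith
  have hqs : ∑ φ, q φ =
      144 - 8 * ∑ φ, charSum univ x φ - ∑ φ, charSum univ x φ ^ 2 + 416 := by
    simp only [hq, sum_add_distrib, sum_sub_distrib, ← mul_sum, sum_ite_eq', mem_univ, if_true]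
    simp
  have hq_nonneg : 0 ≤ ∑ φ, q φ := sum_nonneg fun φ _ => hq0 φ
  have hr : #{h | x h = 0} = 1 := by omega
  have hq_zero : ∑ φ, q φ = 0 := by omega
  -- Equality forces F to be 1 or -9 away from 0, so 10 divides F - 1; adding 4 at 0 turns 16 into
  -- 20. The total, however, is 16 - 16 + 4 = 4.
  have hdvd : (10 : ℤ) ∣ ∑ φ, (charSum univ x φ - 1 + if φ = 0 then 4 else 0) := by
    refine dvd_sum fun φ _ => ?_
    have hqφ := (sum_eq_zero_iff_of_nonneg fun φ _ => hq0 φ).1 hq_zero φ (mem_univ φ)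
    simp only [hq] at hqφ
    split_ifs at hqφ ⊢ with h
    · rw [h, F0]; norm_num
    · have : (charSum univ x φ - 1) * (charSum univ x φ + 9) = 0 := by linarith
      rcases mul_eq_zero.1 this with h | h <;> omega
  rw [sum_add_distrib, sum_sub_distrib, s1, hr] at hdvd
  norm_num at hdvd

theorem exists_fourteen_le_weight_of_ne_zero (hcard : Fintype.card ι = 17)
    (hw : ∀ φ ≠ 0, 8 ≤ weight univ x φ)
    (hdisj : Pairwise fun j j' => Disjoint (R j) (R j'))
    (hne : ∀ j, (R j).Nonempty) (hsum : ∀ j, ∑ h ∈ R j, x h = 0)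
    (hzero : #{h | x h = 0} = 0) :
    ∃ φ, 14 ≤ weight univ x φ := by
  have h1 := three_mul_card_le hdisj hne hsum
  rw [hcard, hzero, Fintype.card_fin] at h1
  obtain ⟨S, hS, hS7⟩ := exists_subset_card_eq (show 7 ≤ #(pairIndices x R) by omega)
  choose r hr using hne
  have hx0 {j} (hj : j ∈ S) : x (r j) ≠ 0 := (mem_pairIndices.1 (hS hj)).1 _ (hr j)
  have hfib {j} (hj : j ∈ S) : R j ⊆ ({h | x h = x (r j)} : Finset ι) := fun h hh => by
    simp [eq_of_mem_pair hsum (hS hj) hh (hr j)]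
  have hR2 {j} (hj : j ∈ S) : #(R j) = 2 := (mem_pairIndices.1 (hS hj)).2
  have hfib2 {j} (hj : j ∈ S) : 2 ≤ #{h | x h = x (r j)} := 
    (hR2 hj).symm.le.trans (card_le_card (hfib hj))
  obtain ⟨φ, hφ⟩ := exists_forall_dotProduct_eq_one_of_sumFree S (fun j => x (r j)) hS7
    -- Two disjoint pairs with the same value would give a fiber of size 4 > 3.
    (by
      intro j hj k hk hjk
      by_contra hne
      have hle := card_le_card (union_subset (hfib hj) ((hfib hk).trans_eq (by
        simp only at hjk
        rw [hjk])))
      rw [card_union_of_disjoint (hdisj hne), hR2 hj, hR2 hk] at hle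
      have := card_fiber_le x hcard hw (hx0 hj)
      omega)
    -- Three pairs on a line would give 6 > 5 vectors on it.
    (by
      intro j hj k hk l hl h
      have hle := card_fibers_line_le x hcard hw (hx0 hj) (hx0 hk) (h ▸ hx0 hl)
      rw [← h] at hle
      have := hfib2 hj
      have := hfib2 hk
      have := hfib2 hl
      omega)
  refine ⟨φ, ?_⟩
  rw [show 14 = 2 * #S by rw [hS7], ← card_biUnion_pairs hdisj hS]
  refine card_le_card fun h hh => ?_
  obtain ⟨j, hj, hhj⟩ := mem_biUnion.1 hh
  simp [eq_of_mem_pair hsum (hS hj) hhj (hr j), hφ j hj]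

/-- If seventeen vectors of `𝔽₂⁴` span a code of minimum distance at least `8` and contain eight
disjoint nonempty zero-sum subfamilies, then at least fourteen of them avoid a hyperplane. -/
theorem exists_fourteen_le_weight (hcard : Fintype.card ι = 17)
    (hw : ∀ φ ≠ 0, 8 ≤ weight univ x φ)
    (hdisj : Pairwise fun j j' => Disjoint (R j) (R j'))
    (hne : ∀ j, (R j).Nonempty) (hsum : ∀ j, ∑ h ∈ R j, x h = 0) :
    ∃ φ, 14 ≤ weight univ x φ := by
  rcases Nat.eq_zero_or_pos #{h | x h = 0} with h | h
  · exact exists_fourteen_le_weight_of_ne_zero x R hcard hw hdisj hne hsum h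
  · exact exists_fourteen_le_weight_of_zero x R hcard hw hdisj hne hsum h

end Projection

/-! ### Minimum distance and the bound 18 -/

section LowerBound

variable {ι : Type*} [Fintype ι] {s k : ℕ}

/-- Every information bit has `k` disjoint recovery sets in the family `x` of columns. -/
def HasRecoverySets (x : ι → Fin s → ZMod 2) (k : ℕ) : Prop :=
  ∀ i, ∃ R : Fin k → Finset ι, (Pairwise fun j j' => Disjoint (R j) (R j')) ∧
    ∀ j, ∑ h ∈ R j, x h = Pi.single i 1

/-- If `f i = 1`, then `f` sums to 1 over each recovery set of `i`, so each of these disjoint sets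
contains a column outside the hyperplane. -/
theorem HasRecoverySets.le_weight {x : ι → Fin s → ZMod 2} (hx : HasRecoverySets x k)
    {f : Fin s → ZMod 2} (hf : f ≠ 0) : k ≤ weight univ x f := by
  obtain ⟨i, hi⟩ : ∃ i, f i ≠ 0 := by
    by_contra! h
    exact hf (funext h)
  obtain ⟨R, hdisj, hR⟩ := hx i
  have h1 (j : Fin k) : ∃ h ∈ R j, f ⬝ᵥ x h = 1 := by
    by_contra! h
    refine hi ?_
    have h0 : f ⬝ᵥ ∑ h ∈ R j, x h = 0 := by
      rw [dotProduct_sum]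
      refine sum_eq_zero fun l hl => ?_
      have := h l hl
      generalize f ⬝ᵥ x l = a at this
      revert a; decide
    simpa [hR] using h0
  choose r hr hr1 using h1
  have hinj : Function.Injective r := fun j j' h => by
    by_contra hne
    exact disjoint_left.1 (hdisj hne) (hr j) (h ▸ hr j')
  have := card_le_card_of_injOn (s := univ) (t := {h | f ⬝ᵥ x h = 1}) r
    (fun j _ => by simp [hr1]) hinj.injOn
  simpa [weight] using this

variable [DecidableEq ι]

theorem HasRecoverySets.exists_weight {x : ι → Fin 5 → ZMod 2} (hx : HasRecoverySets x 8)
    (hcard : Fintype.card ι = 17) (i : Fin 5) :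
    ∃ f : Fin 5 → ZMod 2, f i = 0 ∧ 14 ≤ weight univ x f := by
  have hw (φ : Fin 4 → ZMod 2) :
      weight univ (fun h => i.removeNth (x h)) φ = weight univ x (i.insertNth 0 φ) := by
    have h (l : ι) : φ ⬝ᵥ i.removeNth (x l) = i.insertNth 0 φ ⬝ᵥ x l := by
      simp [dotProduct, Fin.sum_univ_succAbove _ i, Fin.removeNth]
    simp only [weight, h]
  obtain ⟨R, hdisj, hR⟩ := hx i
  obtain ⟨φ, hφ⟩ := exists_fourteen_le_weight (fun h => i.removeNth (x h)) R hcard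
    (fun φ hφ => by
      rw [hw]
      refine hx.le_weight fun h => hφ (funext fun l => ?_)
      simpa using congrFun h (i.succAbove l))
    hdisj
    (fun j => by
      rw [nonempty_iff_ne_empty]
      intro h
      simpa [h] using congrFun (hR j) i)
    (fun j => by
      ext l
      have := congrFun (hR j) (i.succAbove l)
      simpa [Fin.removeNth] using this)
  exact ⟨i.insertNth 0 φ, by simp, hw φ ▸ hφ⟩

theorem not_hasRecoverySets_five_eight (x : ι → Fin 5 → ZMod 2)
    (hcard : Fintype.card ι = 17) : ¬ HasRecoverySets x 8 := by
  intro hx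
  choose f hf0 hf using hx.exists_weight hcard
  have hconst (i j : Fin 5) : f i = f j := by
    by_contra hne
    have hle := hx.le_weight (f := f i + f j) fun h => hne (eq_of_add_eq_zero h)
    have hcompl (i : Fin 5) : #{h | ¬ f i ⬝ᵥ x h = 1} ≤ 3 := by
      have := card_filter_add_card_filter_not (s := univ) (fun h => f i ⬝ᵥ x h = 1)
      have h14 := hf i
      rw [card_univ, hcard] at this
      unfold weight at h14
      omega
    have hsub : ({h | (f i + f j) ⬝ᵥ x h = 1} : Finset ι) ⊆
        ({h | ¬ f i ⬝ᵥ x h = 1} : Finset ι) ∪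
          ({h | ¬ f j ⬝ᵥ x h = 1} : Finset ι) := by
      intro h
      simp only [mem_filter, mem_univ, true_and, mem_union, add_dotProduct]
      generalize f i ⬝ᵥ x h = a
      generalize f j ⬝ᵥ x h = b
      revert a b; decide
    have := (card_le_card hsub).trans (card_union_le _ _)
    have := hcompl i
    have := hcompl j
    unfold weight at hle
    omega
  have h0 : f 0 = 0 := funext fun i => by rw [hconst 0 i, hf0 i]; rfl
  have := hf 0
  simp [h0, weight] at this

end LowerBound

/-- Appending zero columns preserves the recovery sets, so every length below 18 reduces to 17. -/
theorem HasRecoverySets.pad {s k n N : ℕ} {x : Fin n → Fin s → ZMod 2}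
    (hx : HasRecoverySets x k) (hn : n ≤ N) :
    ∃ y : Fin N → Fin s → ZMod 2, HasRecoverySets y k := by
  refine ⟨fun h => if hh : h.1 < n then x ⟨h, hh⟩ else 0, fun i => ?_⟩
  obtain ⟨R, hdisj, hR⟩ := hx i
  refine ⟨fun j => (R j).map (Fin.castLEEmb hn), fun j j' hne => ?_, fun j => ?_⟩
  · simpa using hdisj hne
  · simpa using hR j

theorem eighteen_le_of_mem_pirLengths {n : ℕ} (hn : n ∈ pirLengths 5 8) : 18 ≤ n := by
  obtain ⟨C, -, G, -, hG⟩ := hn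
  by_contra! hlt
  have hx : HasRecoverySets G.col 8 := hG
  obtain ⟨y, hy⟩ := hx.pad (show n ≤ 17 by omega)
  exact not_hasRecoverySets_five_eight y (Fintype.card_fin 17) hy

/-! ### The code of length 18 -/

/-- Linear independence of the rows comes for free: every nontrivial combination of them has weight
at least `k > 0`. -/
theorem mem_pirLengths_of_hasRecoverySets {s k n : ℕ} (hk : 0 < k)
    (G : Matrix (Fin s) (Fin n) (ZMod 2)) (hG : HasRecoverySets G.col k) :
    n ∈ pirLengths s k := by
  have hli : LinearIndependent (ZMod 2) G.row := by
    rw [Fintype.linearIndependent_iff]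
    intro c hc
    by_contra! h
    obtain ⟨i, hi⟩ := h
    have hle := hG.le_weight (f := c) fun h => hi (congrFun h i)
    have h0 : weight univ G.col c = 0 := by
      rw [weight, card_eq_zero, filter_eq_empty_iff]
      intro h _ h1
      have := congrFun hc h
      simp only [Finset.sum_apply, Pi.smul_apply, smul_eq_mul, Pi.zero_apply] at this
      exact zero_ne_one (this.symm.trans h1)
    omega
  exact ⟨_, by rw [finrank_span_eq_card hli, Fintype.card_fin], G, ⟨hli, rfl⟩, hG⟩

/-- A generator matrix of a `5`-dimensional `8`-PIR code of length `18`. -/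
def generator : Matrix (Fin 5) (Fin 18) (ZMod 2) :=
  !![0, 1, 0, 1, 0, 0, 1, 0, 1, 0, 0, 1, 0, 1, 0, 1, 0, 1;
     1, 1, 0, 1, 0, 1, 1, 0, 0, 1, 0, 0, 1, 1, 0, 0, 1, 1;
     0, 0, 1, 1, 0, 0, 0, 1, 1, 1, 0, 0, 0, 0, 1, 1, 0, 1;
     0, 0, 0, 0, 1, 1, 1, 1, 1, 1, 0, 0, 0, 0, 0, 0, 1, 1;
     0, 0, 0, 0, 0, 0, 0, 0, 0, 0, 1, 1, 1, 1, 1, 1, 1, 1]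

/-- Eight disjoint recovery sets with respect to `generator` for each information bit. -/
def recoverySets : Fin 5 → Fin 8 → Finset (Fin 18) :=
  ![![{0, 1}, {5, 6}, {7, 8}, {10, 11}, {12, 13}, {14, 15}, {2, 16, 17}, {3, 4, 9}],
    ![{0}, {4, 5}, {7, 9}, {10, 12}, {11, 13}, {1, 14, 15}, {2, 6, 8}, {3, 16, 17}],
    ![{2}, {1, 3}, {4, 7}, {5, 9}, {10, 14}, {11, 15}, {0, 6, 8}, {12, 13, 16, 17}],
    ![{4}, {0, 5}, {1, 6}, {2, 7}, {12, 16}, {3, 10, 17}, {8, 11, 14}, {9, 13, 15}],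
    ![{10}, {0, 12}, {1, 13}, {2, 14}, {5, 16}, {3, 4, 17}, {6, 9, 15}, {7, 8, 11}]]

theorem hasRecoverySets_generator : HasRecoverySets generator.col 8 := fun i =>
  ⟨recoverySets i, by revert i; unfold Pairwise; decide, by revert i; decide⟩

end PIR

theorem mainTheorem1 : pirLength 5 8 = 18 :=
  IsLeast.csInf_eq ⟨PIR.mem_pirLengths_of_hasRecoverySets (by norm_num) PIR.generator
    PIR.hasRecoverySets_generator, fun _ => PIR.eighteen_le_of_mem_pirLengths⟩
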